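/- **Setting.** Let $p\ge 1$. A unit is $(X,Y(1),Y(0),T)\in\mathbb R^p\times\mathbb R\times\mathbb R\times\{0,1\}$ with law $P$; its individual treatment effect is $\Delta=Y(1)-Y(0)$, and $(X,Y,T)$ with $Y=TY(1)+(1-T)Y(0)$ is observed. Let $\mathcal P_{\mathrm{SI}}^{\mathrm{str}}$ be the class of all laws $P$ such that at least one coordinate of $X$ has an absolutely continuous law, $Y(1)$ and $Y(0)$ have continuous distribution functions, $(Y(1),Y(0))\perp T\mid X$, and $P(T=1\mid X)\in[c_P,1-c_P]$ almost surely for some $c_P>0$. A (possibly randomized) conformal meta-learner is given $n$ observed i.i.d. units, split into a training fold and a calibration fold $\mathcal I$. On the training fold it fits a pseudo-outcome $\varphi(x,y,t)$ that replaces $\Delta$, and a nonconformity score $V(x,\delta)$ (for example $|\delta-\hat\tau(x)|$), both measurable. With the pseudo scores $V_{\varphi,i}=V(X_i,\varphi(X_i,Y_i,T_i))$, $i\in\mathcal I$, the conformal pseudo-interval at level $1-\alpha$ is $$\widehat C_\varphi(x)=\{\delta\in\mathbb R: V(x,\delta)\le \hat q_{1-\alpha}\},$$ where $\hat q_{1-\alpha}$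 is the $\lceil(1-\alpha)(|\mathcal I|+1)\rceil$-th smallest of the $V_{\varphi,i}$, $i\in\mathcal I$, and $+\infty$ if this rank exceeds $|\mathcal I|$. Below, $\mathbb P_P$ and $\mathbb E_P$ are taken over the $n$ units, an independent new unit from $P$ with covariates $X$ and effect $\Delta$, and the internal randomness. The validity threshold $\alpha^*(P)$ is the largest $a\in[0,1]$ such that $\mathbb P_P(\Delta\notin\widehat C_\varphi(X))\le\alpha$ for every $\alpha\in(0,a)$. **Corollary.** Suppose that $\alpha^*(P)\ge\epsilon>0$ for all $P\in\mathcal P_{\mathrm{SI}}^{\mathrm{str}}$. Let $0<\alpha\le\epsilon$ with $\alpha<1$; in the boundary case $\alpha=\epsilon$ suppose also that the threshold is itself an admissible level whenever it equals $\epsilon$, i.e. $\mathbb P_P(\Delta\notin\widehat C_\varphi(X))\le\epsilon$ at level $1-\epsilon$ for every $P\in\mathcal P_{\mathrm{SI}}^{\mathrm{str}}$ with $\alpha^*(P)=\epsilon$. Then the conformal pseudo-interval $\widehat C_\varphi$ at level $1-\alpha$ satisfies $$\mathbb P_P\bigl(y\notin\widehat C_\varphi(X)\bigr)\le\alpha\qquad\text{for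 all }P\in\mathcal P_{\mathrm{SI}}^{\mathrm{str}}\text{ and all }y\in\mathbb R.$$ Consequently $\mathbb E_P[\mathrm{length}(\widehat C_\varphi(X))]=\infty$ for every $P\in\mathcal P_{\mathrm{SI}}^{\mathrm{str}}$, where length is Lebesgue measure, and in particular $$\sup_{P\in\mathcal P_{\mathrm{SI}}^{\mathrm{str}}}\mathbb E_P\bigl[\mathrm{length}(\widehat C_\varphi(X))\bigr]=\infty .$$ -/

import Mathlib

open MeasureTheory ProbabilityTheory

noncomputable section

namespace ITE

/-- Full data of one unit: `(X, Y(1), Y(0), T)`, with `X ∈ ℝ^p` and `T = true` for treated. -/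
abbrev Full (p : ℕ) : Type := (Fin p → ℝ) × ℝ × ℝ × Bool

/-- Observed data of one unit: `(X, Y, T)`. -/
abbrev Obs (p : ℕ) : Type := (Fin p → ℝ) × ℝ × Bool

namespace Full

variable {p : ℕ}

/-- The covariates `X`. -/
def cov (ω : Full p) : Fin p → ℝ := ω.1

/-- The potential outcome `Y(1)`. -/
def y1 (ω : Full p) : ℝ := ω.2.1

/-- The potential outcome `Y(0)`. -/
def y0 (ω : Full p) : ℝ := ω.2.2.1

/-- The treatment indicator `T`. -/
def treat (ω : Full p) : Bool := ω.2.2.2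

/-- The individual treatment effect `Δ = Y(1) - Y(0)`. -/
def effect (ω : Full p) : ℝ := ω.y1 - ω.y0

/-- The observed part `(X, Y, T)` of a unit, where `Y = T Y(1) + (1 - T) Y(0)`. -/
def observe (ω : Full p) : Obs p := (ω.cov, if ω.treat then ω.y1 else ω.y0, ω.treat)

theorem measurable_cov : Measurable (cov : Full p → Fin p → ℝ) := measurable_fst

end Full

/-- The class `𝓔`: at least one coordinate of `X` has an absolutely continuous law, and the laws
of `Y(1)` and of `Y(0)` are continuous (have no atoms, i.e. continuous cdfs).  `T` is binary by its type. -/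
def classE (p : ℕ) : Set (ProbabilityMeasure (Full p)) :=
  {P | (∃ j : Fin p, (P : Measure (Full p)).map (fun ω => ω.cov j) ≪ volume) ∧
    (∀ c : ℝ, (P : Measure (Full p)) {ω | ω.y1 = c} = 0) ∧
    (∀ c : ℝ, (P : Measure (Full p)) {ω | ω.y0 = c} = 0)}

/-- The `σ`-algebra generated by the covariates. -/
abbrev covSigma (p : ℕ) : MeasurableSpace (Full p) :=
  MeasurableSpace.comap (Full.cov : Full p → Fin p → ℝ) inferInstance

theorem covSigma_le (p : ℕ) : covSigma p ≤ (inferInstance : MeasurableSpace (Full p)) :=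
  Full.measurable_cov.comap_le

/-- The strong-ignorability class: members of `𝓔` under which `(Y(1), Y(0)) ⊥ T | X`. -/
def classSI (p : ℕ) : Set (ProbabilityMeasure (Full p)) :=
  {P | P ∈ classE p ∧
    CondIndepFun (covSigma p) (covSigma_le p) (fun ω : Full p => (ω.y1, ω.y0)) Full.treat
      (P : Measure (Full p))}

/-- The propensity score `e_P(X) = P(T = 1 | X)`, as a random variable. -/
def propensity {p : ℕ} (P : ProbabilityMeasure (Full p)) : Full p → ℝ :=
  (P : Measure (Full p))⟦{ω : Full p | ω.treat = true} | covSigma p⟧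

/-- The strong-overlap class: strong ignorability, and `e_P(X) ∈ [c, 1 - c]` almost surely for
some `c > 0` that may depend on `P`. -/
def classSIstr (p : ℕ) : Set (ProbabilityMeasure (Full p)) :=
  {P | P ∈ classSI p ∧
    ∃ c : ℝ, 0 < c ∧ ∀ᵐ ω ∂(P : Measure (Full p)), propensity P ω ∈ Set.Icc c (1 - c)}

/-- The split-conformal quantile at level `1 - α` of the scores `v i`, `i ∈ s`: the
`⌈(1 - α)(|s| + 1)⌉`-th smallest of them, and `+∞` if this rank exceeds `|s|`. -/
def conformalQuantile {ι : Type*} (s : Finset ι) (v : ι → ℝ) (α : ℝ) : EReal :=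
  sInf {q : EReal | (1 - α) * ((s.card : ℝ) + 1) ≤
    (((s.filter fun i => (v i : EReal) ≤ q).card : ℕ) : ℝ)}

/-- A (possibly randomized) conformal meta-learner on `n` observed units, with internal
randomness `u : U`.  The units are split into a calibration fold and its complement, the training
fold.  All nuisance estimates (propensity score, outcome regressions, the estimator `τ̂` of the
treatment effect) are fitted on the training fold, and enter through
* the pseudo-outcome `Ỹ = φ(X, Y, T)` that replaces the unobserved effect `Δ`, and
* the nonconformity score `V(x, δ)`, for instance `|δ - τ̂(x)|`. -/
structure ConformalMetaLearner (p n : ℕ) (U : Type*) [MeasurableSpace U] where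
  /-- the calibration fold -/
  calib : U → Finset (Fin n)
  /-- the pseudo-outcome `φ`, fitted on data `d`, evaluated at an observed unit -/
  pseudo : U → (Fin n → Obs p) → Obs p → ℝ
  /-- the nonconformity score `V`, fitted on data `d`, evaluated at `(x, δ)` -/
  score : U → (Fin n → Obs p) → (Fin p → ℝ) → ℝ → ℝ
  pseudo_train : ∀ u d d', (∀ i, i ∉ calib u → d i = d' i) → pseudo u d = pseudo u d'
  score_train : ∀ u d d', (∀ i, i ∉ calib u → d i = d' i) → score u d = score u d'
  measurable_calib : ∀ i, MeasurableSet {u | i ∈ calib u}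
  measurable_pseudo :
    Measurable fun z : U × (Fin n → Obs p) × Obs p => pseudo z.1 z.2.1 z.2.2
  measurable_score :
    Measurable fun z : U × (Fin n → Obs p) × (Fin p → ℝ) × ℝ =>
      score z.1 z.2.1 z.2.2.1 z.2.2.2

namespace ConformalMetaLearner

variable {p n : ℕ} {U : Type*} [MeasurableSpace U]

/-- The pseudo score `V_φ` of an observed unit: the score of its pseudo-outcome. -/
def pseudoScore (M : ConformalMetaLearner p n U) (u : U) (d : Fin n → Obs p) (o : Obs p) : ℝ :=
  M.score u d o.1 (M.pseudo u d o)

/-- The conformal pseudo-interval `Ĉ_φ(x)` at nominal level `1 - α`: all `δ` whose score is at most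
the conformal quantile of the pseudo scores of the calibration fold. -/
def pseudoInterval (M : ConformalMetaLearner p n U) (α : ℝ) (u : U) (d : Fin n → Obs p)
    (x : Fin p → ℝ) : Set ℝ :=
  {δ | (M.score u d x δ : EReal) ≤
    conformalQuantile (M.calib u) (fun i => M.pseudoScore u d (d i)) α}

/-- The joint law, for `n` i.i.d. units from `P`, an independent new unit from `P`, and the
independent internal randomness of law `ρ`. -/
def jointLaw (n : ℕ) (ρ : Measure U) (P : ProbabilityMeasure (Full p)) :
    Measure ((Fin n → Full p) × Full p × U) :=
  (Measure.pi fun _ : Fin n => (P : Measure (Full p))).prod ((P : Measure (Full p)).prod ρ)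

/-- `Ĉ_φ(X)` for the new unit, as a random set on the joint sample space; it only uses the observed
data of the `n` units, the covariates of the new unit and the internal randomness. -/
def randomInterval (M : ConformalMetaLearner p n U) (α : ℝ)
    (z : (Fin n → Full p) × Full p × U) : Set ℝ :=
  M.pseudoInterval α z.2.2 (fun i => (z.1 i).observe) z.2.1.cov

/-- `ℙ_P(y ∉ Ĉ_φ(X))` for a fixed real `y`. -/
def missProb (M : ConformalMetaLearner p n U) (ρ : Measure U) (P : ProbabilityMeasure (Full p))
    (α y : ℝ) : ENNReal :=
  jointLaw n ρ P {z | y ∉ M.randomInterval α z}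

/-- Validity at level `1 - α` under `P`: `ℙ_P(Δ ∉ Ĉ_φ(X)) ≤ α`. -/
def IsValidAt (M : ConformalMetaLearner p n U) (ρ : Measure U) (P : ProbabilityMeasure (Full p))
    (α : ℝ) : Prop :=
  jointLaw n ρ P {z | z.2.1.effect ∉ M.randomInterval α z} ≤ ENNReal.ofReal α

/-- The validity threshold `α*(P)`: the largest `a ∈ [0, 1]` such that `Ĉ_φ` is valid under `P` at
level `1 - α` for every `α ∈ (0, a)`. -/
def validityThreshold (M : ConformalMetaLearner p n U) (ρ : Measure U)
    (P : ProbabilityMeasure (Full p)) : ℝ :=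
  sSup {a : ℝ | 0 ≤ a ∧ a ≤ 1 ∧ ∀ α : ℝ, 0 < α → α < a → M.IsValidAt ρ P α}

/-- `𝔼_P[length(Ĉ_φ(X))]`. -/
def expectedLength (M : ConformalMetaLearner p n U) (ρ : Measure U)
    (P : ProbabilityMeasure (Full p)) (α : ℝ) : ENNReal :=
  ∫⁻ z, volume (M.randomInterval α z) ∂(jointLaw n ρ P)

end ConformalMetaLearner

end ITE

end

/-! The observed data never contain both potential outcomes, so the effect can be altered where it
is not seen. Let `t` be a deterministic rule assigning treatment from the covariates. Under `t`, the
unseen outcome of a unit can be replaced by a function of its covariates and seen outcome so that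
the effect is exactly `y`, and nothing observed changes. Ignorability survives because the change
depends on the treatment only through `X`. Overlap fails, but it is restored if each unit departs
from `t` with probability `δ`: the resulting law lies in the strong-overlap class, its effect is `y`
almost surely, and all `n` units obey `t` with probability at least `(1 - 2δ) ^ n`. Validity for
this law, as `δ → 0`, bounds by `α` the probability of missing `y` when treatments follow `t`
(`lintegral_missWeight_le`).

A general law has randomized treatment, so it must be compared with deterministic rules. Some
coordinate of `X` has no atoms, hence the `n` units almost surely fall in distinct cells of a fine
grid. One uniform variable per cell then acts on the sample exactly like one per unit; yet once the
cell variables are fixed, treatment is a deterministic rule in `x`. Averaging the bound over the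
cell variables and refining the grid by Fatou's lemma gives the bound for the original law
(`lintegral_assignRandom_le`, with `exists_eq_assignLaw` to represent that law).

Finally, if every real is covered with probability at least `1 - α > 0`, Tonelli's theorem makes the
expected length infinite. -/

namespace ITE

/-! ### Laws with treatment randomized given the covariates -/

open scoped unitInterval

/-- The triple `(X, Y(1), Y(0))` of a unit, without its treatment. -/
abbrev Potential (p : ℕ) : Type := (Fin p → ℝ) × ℝ × ℝ

variable {p : ℕ}

/-- Forgets the treatment of a unit. -/
def Full.potential (ω : Full p) : Potential p := (ω.1, ω.2.1, ω.2.2.1)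

/-- The unit with covariates and potential outcomes `w` and treatment `b`. -/
def Potential.assign (w : Potential p) (b : Bool) : Full p := (w.1, w.2.1, w.2.2, b)

theorem Full.measurable_potential : Measurable (Full.potential : Full p → Potential p) := by
  unfold Full.potential; fun_prop

theorem Full.measurable_treat : Measurable (Full.treat : Full p → Bool) := by
  unfold Full.treat; fun_prop

theorem Full.measurable_y1 : Measurable (Full.y1 : Full p → ℝ) := by
  unfold Full.y1; fun_prop

theorem Full.measurable_y0 : Measurable (Full.y0 : Full p → ℝ) := by
  unfold Full.y0; fun_prop

theorem Potential.measurable_assign :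
    Measurable (fun z : Potential p × Bool => Potential.assign z.1 z.2) := by
  unfold Potential.assign; fun_prop

/-- Treatment with probability `g x` at covariates `x`, decided by the uniform variable `z.2`. -/
noncomputable def assignRandom (g : (Fin p → ℝ) → I) (z : Potential p × I) : Full p :=
  Potential.assign z.1 (decide (z.2 ≤ g z.1.1))

theorem measurable_decide_le {α : Type*} [MeasurableSpace α] {f g : α → I}
    (hf : Measurable f) (hg : Measurable g) : Measurable fun a => decide (f a ≤ g a) :=
  measurable_to_bool (by
    have : (fun a => decide (f a ≤ g a)) ⁻¹' {true} = {a | f a ≤ g a} := by ext; simp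
    rw [this]; exact measurableSet_le hf hg)

theorem measurable_assignRandom {g : (Fin p → ℝ) → I} (hg : Measurable g) :
    Measurable (assignRandom g) :=
  Potential.measurable_assign.comp (measurable_fst.prodMk
    (measurable_decide_le measurable_snd (hg.comp (measurable_fst.comp measurable_fst))))

/-- The law of a unit whose covariates and potential outcomes have law `ν`, and which is treated
with probability `g x`, independently of the potential outcomes given `X = x`. -/
noncomputable def assignLaw (ν : Measure (Potential p)) (g : (Fin p → ℝ) → I) :
    Measure (Full p) :=
  (ν.prod volume).map (assignRandom g)

theorem isProbabilityMeasure_assignLaw (ν : Measure (Potential p)) [IsProbabilityMeasure ν]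
    {g : (Fin p → ℝ) → I} (hg : Measurable g) : IsProbabilityMeasure (assignLaw ν g) :=
  Measure.isProbabilityMeasure_map (measurable_assignRandom hg).aemeasurable

theorem map_potential_assignLaw (ν : Measure (Potential p)) [IsProbabilityMeasure ν]
    {g : (Fin p → ℝ) → I} (hg : Measurable g) :
    (assignLaw ν g).map Full.potential = ν := by
  rw [assignLaw, Measure.map_map Full.measurable_potential (measurable_assignRandom hg)]
  have : Full.potential ∘ assignRandom g = Prod.fst := rfl
  rw [this, Measure.map_fst_prod]; simp

/-- The probability that the treatment lies in `s` when the propensity score is `a`. -/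
noncomputable def treatProb (a : I) (s : Set Bool) : ℝ :=
  (volume : Measure I).real {u | decide (u ≤ a) ∈ s}

theorem measurable_treatProb (s : Set Bool) : Measurable fun a => treatProb a s := by
  unfold treatProb Measure.real
  have h : MeasurableSet {z : I × I | decide (z.2 ≤ z.1) ∈ s} :=
    measurable_decide_le measurable_snd measurable_fst (MeasurableSet.of_discrete (s := s))
  exact (measurable_measure_prodMk_left h).ennreal_toReal

theorem treatProb_nonneg (a : I) (s : Set Bool) : 0 ≤ treatProb a s := measureReal_nonneg

theorem treatProb_le_one (a : I) (s : Set Bool) : treatProb a s ≤ 1 := measureReal_le_one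

theorem treatProb_true (a : I) : treatProb a {true} = a := by
  have : {u : I | decide (u ≤ a) ∈ ({true} : Set Bool)} = Set.Iic a := by ext; simp
  rw [treatProb, this, Measure.real, unitInterval.volume_Iic, ENNReal.toReal_ofReal a.2.1]

/-- Fubini: with the potential outcomes fixed, only the uniform variable decides the treatment. -/
theorem assignLaw_apply_inter (ν : Measure (Potential p)) [IsProbabilityMeasure ν]
    {g : (Fin p → ℝ) → I} (hg : Measurable g) {D : Set (Potential p)} (hD : MeasurableSet D)
    (s : Set Bool) :
    assignLaw ν g (Full.potential ⁻¹' D ∩ Full.treat ⁻¹' s) =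
      ∫⁻ w in D, ENNReal.ofReal (treatProb (g w.1) s) ∂ν := by
  have hs : MeasurableSet (Full.potential ⁻¹' D ∩ (Full.treat : Full p → Bool) ⁻¹' s) :=
    (Full.measurable_potential hD).inter (Full.measurable_treat MeasurableSet.of_discrete)
  rw [assignLaw, Measure.map_apply (measurable_assignRandom hg) hs,
    Measure.prod_apply (measurable_assignRandom hg hs), ← lintegral_indicator hD]
  refine lintegral_congr fun w => ?_
  by_cases hw : w ∈ D
  · rw [Set.indicator_of_mem hw, treatProb, ofReal_measureReal]
    congr 1
    ext u
    exact ⟨fun h => h.2, fun h => ⟨hw, h⟩⟩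
  · rw [Set.indicator_of_notMem hw]
    have : Prod.mk w ⁻¹' (assignRandom g ⁻¹' (Full.potential ⁻¹' D ∩ Full.treat ⁻¹' s)) = ∅ := by
      ext u
      simp only [Set.mem_preimage, Set.mem_inter_iff, Set.mem_empty_iff_false, iff_false]
      exact fun h => hw h.1
    rw [this, measure_empty]

theorem measureReal_assignLaw_inter (ν : Measure (Potential p)) [IsProbabilityMeasure ν]
    {g : (Fin p → ℝ) → I} (hg : Measurable g) {D : Set (Potential p)} (hD : MeasurableSet D)
    (s : Set Bool) :
    (assignLaw ν g).real (Full.potential ⁻¹' D ∩ Full.treat ⁻¹' s) =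
      ∫ ω in Full.potential ⁻¹' D, treatProb (g ω.cov) s ∂(assignLaw ν g) := by
  have hm : Measurable fun w : Potential p => treatProb (g w.1) s :=
    (measurable_treatProb s).comp (hg.comp measurable_fst)
  have h1 : ∫ ω in Full.potential ⁻¹' D, treatProb (g ω.cov) s ∂(assignLaw ν g) =
      ∫ w in D, treatProb (g w.1) s ∂ν := by
    conv_rhs => rw [← map_potential_assignLaw ν hg]
    rw [setIntegral_map hD hm.aestronglyMeasurable Full.measurable_potential.aemeasurable]
    rfl
  rw [h1, Measure.real, assignLaw_apply_inter ν hg hD s,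
    integral_eq_lintegral_of_nonneg_ae (Filter.Eventually.of_forall fun _ => treatProb_nonneg _ _)
      hm.aestronglyMeasurable]

/-- The preimage of a rectangle under `(X, (Y(1), Y(0)))`. -/
theorem Full.potential_preimage_prod (B : Set (Fin p → ℝ)) (C : Set (ℝ × ℝ)) :
    Full.potential ⁻¹' (B ×ˢ C) = Full.cov ⁻¹' B ∩ (fun ω : Full p => (ω.y1, ω.y0)) ⁻¹' C := rfl

theorem measurable_outcomes : Measurable fun ω : Full p => (ω.y1, ω.y0) :=
  Full.measurable_y1.prodMk Full.measurable_y0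

theorem measurable_covSigma_cov : Measurable[covSigma p] (Full.cov : Full p → Fin p → ℝ) :=
  comap_measurable _

/-- Under `assignLaw ν g`, the treatment probability given the potential outcomes factors out. -/
theorem condExp_assignLaw_inter (ν : Measure (Potential p)) [IsProbabilityMeasure ν]
    {g : (Fin p → ℝ) → I} (hg : Measurable g) {C : Set (ℝ × ℝ)} (hC : MeasurableSet C)
    (s : Set Bool) :
    (assignLaw ν g)⟦(fun ω : Full p => (ω.y1, ω.y0)) ⁻¹' C ∩ Full.treat ⁻¹' s | covSigma p⟧
      =ᵐ[assignLaw ν g]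
    (assignLaw ν g)⟦(fun ω : Full p => (ω.y1, ω.y0)) ⁻¹' C | covSigma p⟧ *
      fun ω => treatProb (g ω.cov) s := by
  have := isProbabilityMeasure_assignLaw ν hg
  set Q := assignLaw ν g
  set A : Set (Full p) := (fun ω : Full p => (ω.y1, ω.y0)) ⁻¹' C
  have hA : MeasurableSet A := measurable_outcomes hC
  have hT : MeasurableSet ((Full.treat : Full p → Bool) ⁻¹' s) :=
    Full.measurable_treat MeasurableSet.of_discrete
  have hr : StronglyMeasurable[covSigma p] fun ω : Full p => treatProb (g ω.cov) s :=
    (((measurable_treatProb s).comp hg).comp measurable_covSigma_cov).stronglyMeasurable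
  have hb : ∀ ω : Full p, ‖treatProb (g ω.cov) s‖ ≤ 1 := fun ω => by
    rw [Real.norm_of_nonneg (treatProb_nonneg _ _)]; exact treatProb_le_one _ _
  have hi : Integrable (A.indicator fun _ => (1 : ℝ)) Q := (integrable_const _).indicator hA
  have hir : Integrable ((A.indicator fun _ => (1 : ℝ)) * fun ω => treatProb (g ω.cov) s) Q :=
    hi.mul_bdd (c := 1) (hr.mono (covSigma_le p)).aestronglyMeasurable
      (Filter.Eventually.of_forall hb)
  -- The factor `treatProb` is a function of the covariates, so it may be moved inside the
  -- conditional expectation. It remains to compare integrals over events `X ∈ B`.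
  refine Filter.EventuallyEq.trans ?_ (condExp_mul_of_stronglyMeasurable_right hr hir hi)
  symm
  refine ae_eq_condExp_of_forall_setIntegral_eq (covSigma_le p)
    ((integrable_const _).indicator (hA.inter hT))
    (fun S _ _ => integrable_condExp.integrableOn) ?_
    stronglyMeasurable_condExp.aestronglyMeasurable
  rintro S ⟨B, hB, rfl⟩ -
  have hB' : MeasurableSet ((Full.cov : Full p → _) ⁻¹' B) := Full.measurable_cov hB
  rw [setIntegral_condExp (covSigma_le p) hir ⟨B, hB, rfl⟩]
  have h1 : ((A.indicator fun _ => (1 : ℝ)) * fun ω => treatProb (g ω.cov) s) =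
      A.indicator fun ω => treatProb (g ω.cov) s := by
    ext ω; by_cases h : ω ∈ A <;> simp [h]
  rw [h1, setIntegral_indicator hA, setIntegral_indicator (hA.inter hT), setIntegral_const,
    smul_eq_mul, mul_one, ← Set.inter_assoc]
  exact (measureReal_assignLaw_inter ν hg (hB.prod hC) s).symm

theorem condExp_assignLaw_treat (ν : Measure (Potential p)) [IsProbabilityMeasure ν]
    {g : (Fin p → ℝ) → I} (hg : Measurable g) (s : Set Bool) :
    (assignLaw ν g)⟦(Full.treat : Full p → Bool) ⁻¹' s | covSigma p⟧ =ᵐ[assignLaw ν g]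
      fun ω => treatProb (g ω.cov) s := by
  have := isProbabilityMeasure_assignLaw ν hg
  have h := condExp_assignLaw_inter ν hg MeasurableSet.univ s
  simp only [Set.preimage_univ, Set.univ_inter] at h
  refine h.trans ?_
  have h1 : (assignLaw ν g)⟦(Set.univ : Set (Full p)) | covSigma p⟧ = fun _ => (1 : ℝ) := by
    rw [Set.indicator_univ]; exact condExp_const (covSigma_le p) _
  rw [h1]
  exact Filter.Eventually.of_forall fun ω => one_mul _

/-- Randomized assignment given the covariates satisfies strong ignorability. -/
theorem condIndepFun_assignLaw (ν : Measure (Potential p)) [IsProbabilityMeasure ν]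
    {g : (Fin p → ℝ) → I} (hg : Measurable g) [IsFiniteMeasure (assignLaw ν g)] :
    CondIndepFun (covSigma p) (covSigma_le p) (fun ω : Full p => (ω.y1, ω.y0)) Full.treat
      (assignLaw ν g) := by
  rw [condIndepFun_iff_condExp_inter_preimage_eq_mul measurable_outcomes Full.measurable_treat]
  intro C s hC _
  filter_upwards [condExp_assignLaw_inter ν hg hC s, condExp_assignLaw_treat ν hg s] with ω h1 h2
  rw [h1, h2]; rfl

theorem mem_classSIstr_of_eq_assignLaw {P : ProbabilityMeasure (Full p)}
    (ν : Measure (Potential p)) [IsProbabilityMeasure ν] {g : (Fin p → ℝ) → I}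
    (hg : Measurable g) (hP : (P : Measure (Full p)) = assignLaw ν g)
    (hX : ∃ j : Fin p, ν.map (fun w => w.1 j) ≪ volume)
    (h1 : ∀ c : ℝ, ν {w | w.2.1 = c} = 0) (h0 : ∀ c : ℝ, ν {w | w.2.2 = c} = 0)
    {c : ℝ} (hc : 0 < c) (hgc : ∀ x, (g x : ℝ) ∈ Set.Icc c (1 - c)) :
    P ∈ classSIstr p := by
  refine ⟨⟨⟨?_, fun a => ?_, fun a => ?_⟩, ?_⟩, c, hc, ?_⟩
  · obtain ⟨j, hj⟩ := hX
    refine ⟨j, ?_⟩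
    rw [← map_potential_assignLaw ν hg, Measure.map_map (by fun_prop) Full.measurable_potential]
      at hj
    rw [hP]; exact hj
  · have := h1 a
    rw [← map_potential_assignLaw ν hg, Measure.map_apply Full.measurable_potential
      (measurableSet_eq_fun (by fun_prop) (by fun_prop))] at this
    rw [hP]; exact this
  · have := h0 a
    rw [← map_potential_assignLaw ν hg, Measure.map_apply Full.measurable_potential
      (measurableSet_eq_fun (by fun_prop) (by fun_prop))] at this
    rw [hP]; exact this
  · have := isProbabilityMeasure_assignLaw ν hg
    have h := condIndepFun_assignLaw ν hg
    obtain ⟨P, hPP⟩ := P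
    change P = _ at hP
    subst hP
    exact h
  · have h := condExp_assignLaw_treat ν hg {true}
    unfold propensity
    rw [hP]
    filter_upwards [h] with ω h
    have h2 : {ω : Full p | ω.treat = true} = Full.treat ⁻¹' {true} := rfl
    rw [h2, h, treatProb_true]
    exact hgc _

/-- A law on units is determined by the law of the potential outcomes and its treated part. -/
theorem Full.measure_ext {μ ν : Measure (Full p)} [IsFiniteMeasure μ] [IsFiniteMeasure ν]
    (h : μ.map Full.potential = ν.map Full.potential)
    (hT : ∀ B C, MeasurableSet B → MeasurableSet C →
      μ (Full.potential ⁻¹' (B ×ˢ C) ∩ Full.treat ⁻¹' {true}) =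
      ν (Full.potential ⁻¹' (B ×ˢ C) ∩ Full.treat ⁻¹' {true})) : μ = ν := by
  have mT : MeasurableSet ((Full.treat : Full p → Bool) ⁻¹' {true}) :=
    Full.measurable_treat MeasurableSet.of_discrete
  have hT' : (μ.restrict (Full.treat ⁻¹' {true})).map Full.potential =
      (ν.restrict (Full.treat ⁻¹' {true})).map Full.potential := by
    refine Measure.ext_prod fun {B C} hB hC => ?_
    rw [Measure.map_apply Full.measurable_potential (hB.prod hC),
      Measure.map_apply Full.measurable_potential (hB.prod hC), Measure.restrict_apply' mT,
      Measure.restrict_apply' mT]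
    exact hT B C hB hC
  have key : ∀ D, MeasurableSet D → μ (Full.potential ⁻¹' D ∩ Full.treat ⁻¹' {true}) =
      ν (Full.potential ⁻¹' D ∩ Full.treat ⁻¹' {true}) := fun D hD => by
    have := congrArg (fun m => m D) hT'
    simpa only [Measure.map_apply Full.measurable_potential hD, Measure.restrict_apply' mT]
      using this
  -- The untreated part is the total minus the treated part; finiteness allows the cancellation.
  have key' : ∀ D, MeasurableSet D → μ (Full.potential ⁻¹' D \ Full.treat ⁻¹' {true}) =
      ν (Full.potential ⁻¹' D \ Full.treat ⁻¹' {true}) := fun D hD => by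
    have h1 := congrArg (fun m => m D) h
    simp only [Measure.map_apply Full.measurable_potential hD] at h1
    rw [← measure_inter_add_sdiff (μ := μ) _ mT, ← measure_inter_add_sdiff (μ := ν) _ mT,
      key D hD] at h1
    exact (ENNReal.add_right_inj (measure_ne_top _ _)).1 h1
  ext S hS
  rw [← measure_inter_add_sdiff S mT, ← measure_inter_add_sdiff (μ := ν) S mT]
  have e1 : S ∩ Full.treat ⁻¹' {true} =
      Full.potential ⁻¹' {w | Potential.assign w true ∈ S} ∩ Full.treat ⁻¹' {true} := by
    ext ⟨x, a, b, t⟩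
    cases t <;> simp [Full.treat, Full.potential, Potential.assign]
  have e2 : S \ Full.treat ⁻¹' {true} =
      Full.potential ⁻¹' {w | Potential.assign w false ∈ S} \ Full.treat ⁻¹' {true} := by
    ext ⟨x, a, b, t⟩
    cases t <;> simp [Full.treat, Full.potential, Potential.assign]
  have m (b : Bool) : MeasurableSet {w : Potential p | Potential.assign w b ∈ S} :=
    (Potential.measurable_assign.comp (measurable_id.prodMk measurable_const)) hS
  rw [e1, e2, key _ (m true), key' _ (m false)]

/-- Under strong ignorability, the treatment may be re-drawn from the propensity score. -/
theorem exists_eq_assignLaw {P : ProbabilityMeasure (Full p)} (hP : P ∈ classSI p) :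
    ∃ e : (Fin p → ℝ) → I, Measurable e ∧
      (P : Measure (Full p)) = assignLaw ((P : Measure (Full p)).map Full.potential) e := by
  have hm : StronglyMeasurable[covSigma p] (propensity P) := stronglyMeasurable_condExp
  obtain ⟨e, he, hpe⟩ := hm.measurable.exists_eq_measurable_comp
  have mT : MeasurableSet ((Full.treat : Full p → Bool) ⁻¹' {true}) :=
    Full.measurable_treat MeasurableSet.of_discrete
  have hiT : Integrable (((Full.treat : Full p → Bool) ⁻¹' {true}).indicator fun _ => (1 : ℝ))
    (P : Measure (Full p)) := (integrable_const _).indicator mT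
  have h0 : 0 ≤ᵐ[(P : Measure (Full p))] propensity P :=
    condExp_nonneg (Filter.Eventually.of_forall fun _ =>
      Set.indicator_nonneg (fun _ _ => zero_le_one) _)
  have h1 : propensity P ≤ᵐ[(P : Measure (Full p))] fun _ => (1 : ℝ) := by
    rw [← condExp_const (μ := (P : Measure (Full p))) (covSigma_le p) (1 : ℝ)]
    exact condExp_mono hiT (integrable_const _) (Filter.Eventually.of_forall fun ω =>
      Set.indicator_le_self' (fun _ _ => zero_le_one) _)
  -- The propensity is a function `e` of the covariates with values in `[0, 1]` only almost surely;
  -- projecting onto the interval changes it on a null set.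
  let g : (Fin p → ℝ) → I := fun x => Set.projIcc 0 1 zero_le_one (e x)
  have hg : Measurable g := continuous_projIcc.measurable.comp he
  have hge : ∀ᵐ ω ∂(P : Measure (Full p)), (g ω.cov : ℝ) = propensity P ω := by
    filter_upwards [h0, h1] with ω h0 h1
    have h2 : propensity P ω = e ω.cov := congrFun hpe ω
    rw [h2] at h0 h1 ⊢
    simp only [g, Set.projIcc_of_mem zero_le_one (show e ω.cov ∈ Set.Icc 0 1 from ⟨h0, h1⟩)]
  refine ⟨g, hg, ?_⟩
  have : IsProbabilityMeasure ((P : Measure (Full p)).map Full.potential) :=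
    Measure.isProbabilityMeasure_map Full.measurable_potential.aemeasurable
  have := isProbabilityMeasure_assignLaw ((P : Measure (Full p)).map Full.potential) hg
  refine Full.measure_ext (map_potential_assignLaw _ hg).symm fun B C hB hC => ?_
  rw [assignLaw_apply_inter _ hg (hB.prod hC),
    setLIntegral_map (f := fun w : Potential p => ENNReal.ofReal (treatProb (g w.1) {true}))
      (hB.prod hC) (((measurable_treatProb _).comp (hg.comp measurable_fst)).ennreal_ofReal)
      Full.measurable_potential]
  simp only [treatProb_true]
  have hA : MeasurableSet ((fun ω : Full p => (ω.y1, ω.y0)) ⁻¹' C) := measurable_outcomes hC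
  have hi : Integrable (((fun ω : Full p => (ω.y1, ω.y0)) ⁻¹' C).indicator fun _ => (1 : ℝ))
    (P : Measure (Full p)) := (integrable_const _).indicator hA
  have hpi : Integrable (propensity P) (P : Measure (Full p)) := integrable_condExp
  have hip : Integrable ((((fun ω : Full p => (ω.y1, ω.y0)) ⁻¹' C).indicator fun _ => (1 : ℝ)) *
      propensity P) (P : Measure (Full p)) := by
    refine (hpi.indicator hA).congr (Filter.Eventually.of_forall fun ω => ?_)
    by_cases h : ω ∈ ((fun ω : Full p => (ω.y1, ω.y0)) ⁻¹' C) <;> simp [Set.indicator, h] at *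
  have hB' : MeasurableSet[covSigma p] ((Full.cov : Full p → _) ⁻¹' B) := ⟨B, hB, rfl⟩
  have hci := (condIndepFun_iff_condExp_inter_preimage_eq_mul measurable_outcomes
    Full.measurable_treat).1 hP.2 C {true} hC MeasurableSet.of_discrete
  have hpull := condExp_mul_of_stronglyMeasurable_right hm hip hi
  -- Conditional independence turns the conditional probability of the joint event into a product,
  -- and the propensity is then pulled back inside as a function of `X`.
  have e1 : (P : Measure (Full p)).real
      (Full.potential ⁻¹' (B ×ˢ C) ∩ Full.treat ⁻¹' {true}) =
      ∫ ω in Full.potential ⁻¹' (B ×ˢ C), (g ω.cov : ℝ) ∂(P : Measure (Full p)) := by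
    rw [integral_congr_ae (ae_restrict_of_ae hge), Full.potential_preimage_prod,
      ← setIntegral_indicator hA]
    have e2 : (((fun ω : Full p => (ω.y1, ω.y0)) ⁻¹' C).indicator fun ω => propensity P ω) =
      (((fun ω : Full p => (ω.y1, ω.y0)) ⁻¹' C).indicator fun _ => (1 : ℝ)) * propensity P := by
      ext ω; simp [Set.indicator]
    rw [e2, ← setIntegral_condExp (covSigma_le p) hip hB', integral_congr_ae
      (ae_restrict_of_ae (hpull.trans hci.symm)), setIntegral_condExp (covSigma_le p)
        ((integrable_const _).indicator (hA.inter mT)) hB', setIntegral_indicator (hA.inter mT),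
      setIntegral_const, smul_eq_mul, mul_one, Set.inter_assoc]
  rw [← ofReal_measureReal, e1, ofReal_integral_eq_lintegral_ofReal]
  · rfl
  · exact ((hpi.congr (hge.mono fun _ h => h.symm))).integrableOn
  · exact Filter.Eventually.of_forall fun ω => (g ω.cov).2.1

end ITE

/-! ### Measurability of the pseudo-interval, miss probabilities and expected length -/

namespace ITE

theorem Full.measurable_effect {p : ℕ} : Measurable (Full.effect : Full p → ℝ) :=
  Full.measurable_y1.sub Full.measurable_y0

theorem Full.measurable_observe {p : ℕ} : Measurable (Full.observe : Full p → Obs p) := by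
  unfold Full.observe
  refine Full.measurable_cov.prodMk ((Measurable.ite ?_ Full.measurable_y1
    Full.measurable_y0).prodMk Full.measurable_treat)
  exact Full.measurable_treat (MeasurableSet.of_discrete (s := {true}))

/-- A score exceeds the conformal quantile iff enough calibration scores lie strictly below it. -/
theorem coe_le_conformalQuantile_iff {ι : Type*} (s : Finset ι) (v : ι → ℝ) (α x : ℝ) :
    (x : EReal) ≤ conformalQuantile s v α ↔
      ((s.filter fun i => v i < x).card : ℝ) < (1 - α) * ((s.card : ℝ) + 1) := by
  classical
  rw [← not_iff_not, not_le, not_lt, conformalQuantile, sInf_lt_iff]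
  constructor
  · rintro ⟨q, hq, hqx⟩
    refine le_trans hq ?_
    refine Nat.cast_le.2 (Finset.card_le_card fun i hi => ?_)
    rw [Finset.mem_filter] at hi ⊢
    exact ⟨hi.1, EReal.coe_lt_coe_iff.1 (hi.2.trans_lt hqx)⟩
  · intro h
    -- The witness is the largest score below `x`. With no such score it is `⊥`, which is still
    -- below `x`.
    refine ⟨(s.filter fun i => v i < x).sup fun i => (v i : EReal), ?_, ?_⟩
    · refine le_trans h (Nat.cast_le.2 (Finset.card_le_card fun i hi => ?_))
      rw [Finset.mem_filter]
      exact ⟨(Finset.mem_filter.1 hi).1, Finset.le_sup (f := fun i => (v i : EReal)) hi⟩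
    · rw [Finset.sup_lt_iff (EReal.bot_lt_coe x)]
      exact fun i hi => EReal.coe_lt_coe_iff.2 (Finset.mem_filter.1 hi).2

namespace ConformalMetaLearner

variable {p n : ℕ} {U : Type*} [MeasurableSpace U]

theorem measurable_pseudoScore (M : ConformalMetaLearner p n U) :
    Measurable fun z : U × (Fin n → Obs p) × Obs p => M.pseudoScore z.1 z.2.1 z.2.2 := by
  have h := M.measurable_pseudo
  exact M.measurable_score.comp (measurable_fst.prodMk ((measurable_fst.comp measurable_snd).prodMk
    ((measurable_fst.comp (measurable_snd.comp measurable_snd)).prodMk h)))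

theorem measurableSet_mem_pseudoInterval (M : ConformalMetaLearner p n U) (α : ℝ) :
    MeasurableSet {z : ((Fin n → Obs p) × (Fin p → ℝ) × U) × ℝ |
      z.2 ∈ M.pseudoInterval α z.1.2.2 z.1.1 z.1.2.1} := by
  classical
  let sc : ((Fin n → Obs p) × (Fin p → ℝ) × U) × ℝ → ℝ := fun z =>
    M.score z.1.2.2 z.1.1 z.1.2.1 z.2
  have hsc : Measurable sc := M.measurable_score.comp
    (f := fun z : ((Fin n → Obs p) × (Fin p → ℝ) × U) × ℝ => (z.1.2.2, z.1.1, z.1.2.1, z.2))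
    (by fun_prop)
  have hps (i : Fin n) : Measurable fun z : ((Fin n → Obs p) × (Fin p → ℝ) × U) × ℝ =>
      M.pseudoScore z.1.2.2 z.1.1 (z.1.1 i) := M.measurable_pseudoScore.comp
    (f := fun z : ((Fin n → Obs p) × (Fin p → ℝ) × U) × ℝ => (z.1.2.2, z.1.1, z.1.1 i))
    (by fun_prop)
  have hc (i : Fin n) : MeasurableSet {z : ((Fin n → Obs p) × (Fin p → ℝ) × U) × ℝ |
      i ∈ M.calib z.1.2.2} := measurableSet_preimage
        (f := fun z : ((Fin n → Obs p) × (Fin p → ℝ) × U) × ℝ => z.1.2.2) (by fun_prop)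
        (M.measurable_calib i)
  -- The calibration fold is random, so both counts are written as sums of indicators over all of
  -- `Fin n`.
  have e : {z : ((Fin n → Obs p) × (Fin p → ℝ) × U) × ℝ |
      z.2 ∈ M.pseudoInterval α z.1.2.2 z.1.1 z.1.2.1} =
    {z | (∑ i : Fin n, if i ∈ M.calib z.1.2.2 ∧ M.pseudoScore z.1.2.2 z.1.1 (z.1.1 i) < sc z
        then (1 : ℝ) else 0) <
      (1 - α) * ((∑ i : Fin n, if i ∈ M.calib z.1.2.2 then (1 : ℝ) else 0) + 1)} := by
    ext z
    simp only [Set.mem_ofPred_eq, pseudoInterval, coe_le_conformalQuantile_iff, Finset.sum_boole]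
    have h1 : Finset.filter (fun i => i ∈ M.calib z.1.2.2) Finset.univ = M.calib z.1.2.2 := by
      ext; simp
    have h2 : Finset.filter (fun i => i ∈ M.calib z.1.2.2 ∧
        M.pseudoScore z.1.2.2 z.1.1 (z.1.1 i) < sc z) Finset.univ =
        Finset.filter (fun i => M.pseudoScore z.1.2.2 z.1.1 (z.1.1 i) < sc z)
          (M.calib z.1.2.2) := by
      ext; simp
    rw [h1, h2]
  rw [e]
  refine measurableSet_lt ?_ ?_
  · exact Finset.measurable_sum _ fun i _ => Measurable.ite
      ((hc i).inter (measurableSet_lt (hps i) hsc)) measurable_const measurable_const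
  · exact ((Finset.measurable_sum _ fun i _ => Measurable.ite (hc i) measurable_const
      measurable_const).add_const 1).const_mul _

/-- The data on which `randomInterval` depends. -/
def visible (z : (Fin n → Full p) × Full p × U) : (Fin n → Obs p) × (Fin p → ℝ) × U :=
  (fun i => (z.1 i).observe, z.2.1.cov, z.2.2)

theorem measurable_visible :
    Measurable (visible : (Fin n → Full p) × Full p × U → _) := by
  unfold visible
  refine Measurable.prodMk (measurable_pi_lambda _ fun i => ?_) ?_
  · exact Full.measurable_observe.comp ((measurable_pi_apply i).comp measurable_fst)
  · exact (Full.measurable_cov.comp (measurable_fst.comp measurable_snd)).prodMk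
      (measurable_snd.comp measurable_snd)

theorem measurableSet_mem_randomInterval (M : ConformalMetaLearner p n U) (α : ℝ)
    {f : (Fin n → Full p) × Full p × U → ℝ} (hf : Measurable f) :
    MeasurableSet {z | f z ∈ M.randomInterval α z} :=
  (measurable_visible.prodMk hf) (M.measurableSet_mem_pseudoInterval α)

/-- The probability, given the training data `d`, that the pseudo-interval misses `y`. -/
noncomputable def missWeight (M : ConformalMetaLearner p n U) (ρ : Measure U)
    (μ : Measure (Fin p → ℝ)) (α y : ℝ) (d : Fin n → Obs p) : ENNReal :=
  (μ.prod ρ) {q | y ∉ M.pseudoInterval α q.2 d q.1}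

theorem measurableSet_notMem_pseudoInterval (M : ConformalMetaLearner p n U) (α y : ℝ) :
    MeasurableSet {z : (Fin n → Obs p) × (Fin p → ℝ) × U |
      y ∉ M.pseudoInterval α z.2.2 z.1 z.2.1} :=
  (measurable_id.prodMk measurable_const) (M.measurableSet_mem_pseudoInterval α).compl

theorem measurable_missWeight (M : ConformalMetaLearner p n U) (ρ : Measure U) [SFinite ρ]
    (μ : Measure (Fin p → ℝ)) [SFinite μ] (α y : ℝ) : Measurable (M.missWeight ρ μ α y) :=
  measurable_measure_prodMk_left (M.measurableSet_notMem_pseudoInterval α y)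

/-- The new unit enters only through its covariates and the sample only through its observed part.
The miss probability is therefore comparable between laws that share the law of `X`, whatever their
unobserved outcomes. -/
theorem missProb_eq_lintegral (M : ConformalMetaLearner p n U) (ρ : Measure U)
    [IsProbabilityMeasure ρ] (P : ProbabilityMeasure (Full p)) (α y : ℝ) :
    M.missProb ρ P α y =
      ∫⁻ d, M.missWeight ρ ((P : Measure (Full p)).map Full.cov) α y (fun i => (d i).observe)
        ∂(Measure.pi fun _ : Fin n => (P : Measure (Full p))) := by
  have hm : MeasurableSet {z | y ∉ M.randomInterval α z} :=
    (M.measurableSet_mem_randomInterval α measurable_const).compl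
  rw [missProb, jointLaw, Measure.prod_apply hm]
  refine lintegral_congr fun d => ?_
  have e : ((P : Measure (Full p)).map Full.cov).prod ρ =
      ((P : Measure (Full p)).prod ρ).map (Prod.map Full.cov id) := by
    rw [← Measure.map_prod_map _ _ Full.measurable_cov measurable_id, Measure.map_id]
  rw [missWeight, e, Measure.map_apply (Full.measurable_cov.prodMap measurable_id)]
  · rfl
  · exact measurable_prodMk_left (M.measurableSet_notMem_pseudoInterval α y)

instance (ρ : Measure U) [IsProbabilityMeasure ρ] (P : ProbabilityMeasure (Full p)) :
    IsProbabilityMeasure (jointLaw n ρ P) := by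
  unfold jointLaw; infer_instance

/-- An interval that covers every fixed point with probability bounded away from zero has
infinite expected length. -/
theorem expectedLength_eq_top (M : ConformalMetaLearner p n U) (ρ : Measure U)
    [IsProbabilityMeasure ρ] (P : ProbabilityMeasure (Full p)) {α : ℝ} (hα : α < 1)
    (h : ∀ y, M.missProb ρ P α y ≤ ENNReal.ofReal α) : M.expectedLength ρ P α = ⊤ := by
  have hS : MeasurableSet {w : ((Fin n → Full p) × Full p × U) × ℝ |
      w.2 ∈ M.randomInterval α w.1} :=
    ((measurable_visible.comp measurable_fst).prodMk measurable_snd)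
      (M.measurableSet_mem_pseudoInterval α)
  -- Tonelli: the expected length is the integral over `y` of the coverage probability of `y`.
  have e : M.expectedLength ρ P α =
      ∫⁻ y : ℝ, jointLaw n ρ P {z | y ∈ M.randomInterval α z} := by
    have h1 := Measure.prod_apply (μ := jointLaw n ρ P) (ν := (volume : Measure ℝ)) hS
    rw [Measure.prod_apply_symm hS] at h1
    exact h1.symm
  have hle (y : ℝ) : 1 - ENNReal.ofReal α ≤ jointLaw n ρ P {z | y ∈ M.randomInterval α z} := by
    have hm := M.measurableSet_mem_randomInterval (p := p) α (measurable_const (a := y))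
    have h2 := prob_compl_eq_one_sub (μ := jointLaw n ρ P) hm.compl
    rw [compl_compl] at h2
    rw [h2]
    exact tsub_le_tsub_left (h y) _
  rw [e, ← top_le_iff]
  calc (⊤ : ENNReal) = ∫⁻ _ : ℝ, (1 - ENNReal.ofReal α) := by
        rw [lintegral_const, Real.volume_univ, ENNReal.mul_top]
        rw [Ne, tsub_eq_zero_iff_le, not_le]
        exact ENNReal.ofReal_lt_one.2 hα
    _ ≤ _ := lintegral_mono hle

theorem isValidAt_of_lt_validityThreshold (M : ConformalMetaLearner p n U) (ρ : Measure U)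
    (P : ProbabilityMeasure (Full p)) {α : ℝ} (h0 : 0 < α)
    (h : α < M.validityThreshold ρ P) : M.IsValidAt ρ P α := by
  unfold validityThreshold at h
  -- The set defining the threshold contains `0` vacuously.
  obtain ⟨a, ha, hαa⟩ := exists_lt_of_lt_csSup (by
    exact ⟨0, le_rfl, zero_le_one, fun β h1 h2 => absurd (h1.trans h2) (lt_irrefl _)⟩) h
  exact ha.2.2 α h0 hαa

end ConformalMetaLearner

/-- The strong-overlap class is not empty: independent uniform covariates and outcomes, and a
fair coin for the treatment. -/
theorem classSIstr_nonempty {p : ℕ} (hp : 0 < p) : (classSIstr p).Nonempty := by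
  let κ : Measure ℝ := volume.restrict (Set.Icc 0 1)
  have : IsProbabilityMeasure κ := ⟨by simp [κ]⟩
  let ν : Measure (Potential p) := (Measure.pi fun _ => κ).prod (κ.prod κ)
  let g : (Fin p → ℝ) → unitInterval := fun _ => ⟨1 / 2, by norm_num, by norm_num⟩
  have hg : Measurable g := measurable_const
  have hQ := isProbabilityMeasure_assignLaw ν hg
  refine ⟨⟨assignLaw ν g, hQ⟩, mem_classSIstr_of_eq_assignLaw ν hg rfl ⟨⟨0, hp⟩, ?_⟩ ?_ ?_
    (c := 1 / 2) (by norm_num) fun x => ⟨le_rfl, by norm_num [g]⟩⟩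
  · have e : (fun w : Potential p => w.1 ⟨0, hp⟩) = (fun x => x ⟨0, hp⟩) ∘ Prod.fst := rfl
    rw [e, ← Measure.map_map (measurable_pi_apply _) measurable_fst, Measure.map_fst_prod,
      measure_univ, one_smul, (measurePreserving_eval (fun _ => κ) _).map_eq]
    exact Measure.restrict_le_self.absolutelyContinuous
  · intro c
    have e : {w : Potential p | w.2.1 = c} = Set.univ ×ˢ (({c} : Set ℝ) ×ˢ Set.univ) := by
      ext w; simp [eq_comm]
    rw [e, Measure.prod_prod, Measure.prod_prod]
    simp
  · intro c
    have e : {w : Potential p | w.2.2 = c} = Set.univ ×ˢ (Set.univ ×ˢ ({c} : Set ℝ)) := by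
      ext w; simp [eq_comm]
    rw [e, Measure.prod_prod, Measure.prod_prod]
    simp

end ITE

/-! ### Deterministic treatment rules: laws with constant effect and near-deterministic treatment -/

namespace ITE

open scoped unitInterval

variable {p n : ℕ}

theorem pi_assignLaw_eq_map (ν : Measure (Potential p)) [IsProbabilityMeasure ν]
    {g : (Fin p → ℝ) → I} (hg : Measurable g) :
    Measure.pi (fun _ : Fin n => assignLaw ν g) =
      ((Measure.pi fun _ : Fin n => ν).prod (Measure.pi fun _ : Fin n => (volume : Measure I))).map
        (fun z i => assignRandom g (z.1 i, z.2 i)) := by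
  have := isProbabilityMeasure_assignLaw ν hg
  have h := measurePreserving_arrowProdEquivProdArrow (Potential p) I (Fin n) (fun _ => ν)
    (fun _ => volume)
  have hm : Measurable fun (z : (Fin n → Potential p) × (Fin n → I)) (i : Fin n) =>
      assignRandom g (z.1 i, z.2 i) :=
    measurable_pi_lambda _ fun i => (measurable_assignRandom hg).comp (by fun_prop)
  rw [← h.map_eq, Measure.map_map hm h.measurable]
  exact (Measure.pi_map_pi (hμ := fun _ => by
    change SigmaFinite (assignLaw ν g); infer_instance)
    fun _ => (measurable_assignRandom hg).aemeasurable).symm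

theorem lintegral_pi_assignLaw (ν : Measure (Potential p)) [IsProbabilityMeasure ν]
    {g : (Fin p → ℝ) → I} (hg : Measurable g) {f : (Fin n → Full p) → ENNReal}
    (hf : Measurable f) :
    ∫⁻ d, f d ∂(Measure.pi fun _ : Fin n => assignLaw ν g) =
      ∫⁻ w, ∫⁻ u, f (fun i => assignRandom g (w i, u i))
        ∂(Measure.pi fun _ : Fin n => (volume : Measure I)) ∂(Measure.pi fun _ : Fin n => ν) := by
  have hm : Measurable fun (z : (Fin n → Potential p) × (Fin n → I)) (i : Fin n) =>
      assignRandom g (z.1 i, z.2 i) :=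
    measurable_pi_lambda _ fun i => (measurable_assignRandom hg).comp (by fun_prop)
  rw [pi_assignLaw_eq_map ν hg, lintegral_map hf hm]
  exact lintegral_prod _ (hf.comp hm).aemeasurable

/-- Changes the outcome that is not selected by `t` so that the treatment effect is `y`. -/
noncomputable def constEffect (t : (Fin p → ℝ) → Bool) (y : ℝ) (w : Potential p) : Potential p :=
  if t w.1 = true then (w.1, w.2.1, w.2.1 - y) else (w.1, w.2.2 + y, w.2.2)

theorem constEffect_fst (t : (Fin p → ℝ) → Bool) (y : ℝ) (w : Potential p) :
    (constEffect t y w).1 = w.1 := by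
  unfold constEffect; split <;> rfl

theorem measurable_constEffect {t : (Fin p → ℝ) → Bool} (ht : Measurable t) (y : ℝ) :
    Measurable (constEffect t y) := by
  unfold constEffect
  refine Measurable.ite ?_ (by fun_prop) (by fun_prop)
  exact (ht.comp measurable_fst) (MeasurableSet.of_discrete (s := {true}))

theorem effect_assign_constEffect (t : (Fin p → ℝ) → Bool) (y : ℝ) (w : Potential p) (b : Bool) :
    ((constEffect t y w).assign b).effect = y := by
  unfold constEffect Full.effect Full.y1 Full.y0 Potential.assign
  split <;> simp

/-- The altered outcome is the one that `t` leaves unobserved. -/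
theorem observe_assign_constEffect (t : (Fin p → ℝ) → Bool) (y : ℝ) (w : Potential p) :
    ((constEffect t y w).assign (t w.1)).observe = (w.assign (t w.1)).observe := by
  unfold constEffect Full.observe Full.y1 Full.y0 Potential.assign Full.cov Full.treat
  split <;> simp_all

/-- The propensity score that follows the rule `t` except with probability `δ`. -/
noncomputable def nearScore (t : (Fin p → ℝ) → Bool) (δ : I) (x : Fin p → ℝ) : I :=
  if t x = true then unitInterval.symm δ else δ

theorem measurable_nearScore {t : (Fin p → ℝ) → Bool} (ht : Measurable t) (δ : I) :
    Measurable (nearScore t δ) := by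
  unfold nearScore
  exact Measurable.ite (ht (MeasurableSet.of_discrete (s := {true}))) measurable_const
    measurable_const

/-- A uniform draw in `(δ, 1 - δ]` respects `t` whichever value the rule takes; such a draw has
probability `1 - 2δ`. -/
theorem decide_le_nearScore (t : (Fin p → ℝ) → Bool) {δ u : I}
    (hu : u ∈ Set.Ioc δ (unitInterval.symm δ)) (x : Fin p → ℝ) :
    decide (u ≤ nearScore t δ x) = t x := by
  unfold nearScore
  split
  · next h => rw [h]; exact decide_eq_true hu.2
  · next h => rw [Bool.eq_false_of_not_eq_true h]; exact decide_eq_false (not_le.2 hu.1)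

/-- Each altered outcome is either an original one or the other one shifted by `±y`, so no atoms
arise; the covariates are untouched, and `δ` itself serves as the overlap constant. -/
theorem assignLaw_constEffect_mem {P Q : ProbabilityMeasure (Full p)} (hP : P ∈ classE p)
    {t : (Fin p → ℝ) → Bool} (ht : Measurable t) (y : ℝ) {δ : I} (hδ : 0 < (δ : ℝ))
    (hδ' : (δ : ℝ) ≤ 1 / 2)
    (hQ : (Q : Measure (Full p)) =
      assignLaw (((P : Measure (Full p)).map Full.potential).map (constEffect t y))
        (nearScore t δ)) : Q ∈ classSIstr p := by
  have hc := measurable_constEffect ht y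
  have hcp := hc.comp Full.measurable_potential
  rw [Measure.map_map hc Full.measurable_potential] at hQ
  have := Measure.isProbabilityMeasure_map (μ := (P : Measure (Full p))) hcp.aemeasurable
  refine mem_classSIstr_of_eq_assignLaw _ (measurable_nearScore ht δ) hQ ?_ ?_ ?_ hδ ?_
  · obtain ⟨j, hj⟩ := hP.1
    refine ⟨j, ?_⟩
    rw [Measure.map_map (by fun_prop) hcp]
    have e : (fun w : Potential p => w.1 j) ∘ constEffect t y ∘ Full.potential =
        fun ω : Full p => ω.cov j := by
      funext ω; simp only [Function.comp, constEffect_fst]; rfl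
    rw [e]; exact hj
  · intro c
    rw [Measure.map_apply hcp (measurableSet_eq_fun (by fun_prop) (by fun_prop))]
    refine measure_mono_null (t := {ω : Full p | ω.y1 = c} ∪ {ω : Full p | ω.y0 = c - y}) ?_
      (measure_union_null (hP.2.1 c) (hP.2.2 _))
    intro ω hω
    change (constEffect t y ω.potential).2.1 = c at hω
    unfold constEffect at hω
    split at hω
    · exact Or.inl hω
    · exact Or.inr (eq_sub_of_add_eq hω)
  · intro c
    rw [Measure.map_apply hcp (measurableSet_eq_fun (by fun_prop) (by fun_prop))]
    refine measure_mono_null (t := {ω : Full p | ω.y1 = c + y} ∪ {ω : Full p | ω.y0 = c}) ?_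
      (measure_union_null (hP.2.1 _) (hP.2.2 _))
    intro ω hω
    change (constEffect t y ω.potential).2.2 = c at hω
    unfold constEffect at hω
    split at hω
    · exact Or.inl (eq_add_of_sub_eq hω)
    · exact Or.inr hω
  · intro x
    unfold nearScore
    split
    · rw [unitInterval.coe_symm_eq]; constructor <;> linarith
    · constructor <;> linarith

theorem volume_Ioc_symm_pow (δ : I) :
    (Measure.pi fun _ : Fin n => (volume : Measure I))
      (Set.univ.pi fun _ => Set.Ioc δ (unitInterval.symm δ)) =
      ENNReal.ofReal (1 - 2 * (δ : ℝ)) ^ n := by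
  rw [Measure.pi_pi]
  simp only [unitInterval.volume_Ioc, unitInterval.coe_symm_eq, Finset.prod_const,
    Finset.card_univ, Fintype.card_fin]
  congr 2
  ring

namespace ConformalMetaLearner

variable {U : Type*} [MeasurableSpace U]

/-- The only place where coverage of the random effect becomes coverage of a fixed real. -/
theorem missProb_le_of_effect_eq (M : ConformalMetaLearner p n U) (ρ : Measure U)
    [IsProbabilityMeasure ρ] {Q : ProbabilityMeasure (Full p)} {α y : ℝ}
    (hQ : M.IsValidAt ρ Q α) (hy : ∀ᵐ ω ∂(Q : Measure (Full p)), ω.effect = y) :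
    M.missProb ρ Q α y ≤ ENNReal.ofReal α := by
  refine le_trans (measure_mono_ae ?_) hQ
  have hq : Measure.QuasiMeasurePreserving
      (fun z : (Fin n → Full p) × Full p × U => z.2.1) (jointLaw n ρ Q) (Q : Measure (Full p)) :=
    Measure.quasiMeasurePreserving_fst.comp Measure.quasiMeasurePreserving_snd
  filter_upwards [hq.ae hy] with z hz hmem
  change z.2.1.effect ∉ _
  rw [hz]
  exact hmem

/-- If the pseudo-interval is valid throughout the strong-overlap class, then it covers a fixed
point also when the treatments are a deterministic function of the covariates. -/
theorem lintegral_missWeight_le (M : ConformalMetaLearner p n U) (ρ : Measure U)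
    [IsProbabilityMeasure ρ] {α : ℝ} (hvalid : ∀ Q ∈ classSIstr p, M.IsValidAt ρ Q α)
    {P : ProbabilityMeasure (Full p)} (hP : P ∈ classE p) (y : ℝ)
    {t : (Fin p → ℝ) → Bool} (ht : Measurable t) :
    ∫⁻ w, M.missWeight ρ ((P : Measure (Full p)).map Full.cov) α y
        (fun i => ((w i).assign (t (w i).1)).observe)
      ∂(Measure.pi fun _ : Fin n => (P : Measure (Full p)).map Full.potential) ≤
      ENNReal.ofReal α := by
  set ν := (P : Measure (Full p)).map Full.potential
  have : IsProbabilityMeasure ν :=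
    Measure.isProbabilityMeasure_map Full.measurable_potential.aemeasurable
  have hc := measurable_constEffect ht y
  have : IsProbabilityMeasure (ν.map (constEffect t y)) :=
    Measure.isProbabilityMeasure_map hc.aemeasurable
  set h := M.missWeight ρ ((P : Measure (Full p)).map Full.cov) α y with hh
  have : IsProbabilityMeasure ((P : Measure (Full p)).map Full.cov) :=
    Measure.isProbabilityMeasure_map Full.measurable_cov.aemeasurable
  have hhm : Measurable h := M.measurable_missWeight ρ _ α y
  set J := ∫⁻ w, h (fun i => ((w i).assign (t (w i).1)).observe) ∂(Measure.pi fun _ : Fin n => ν)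
  -- The bound at fixed `δ`, with the loss factor for all `n` units obeying `t`.
  have main : ∀ δ : I, 0 < (δ : ℝ) → (δ : ℝ) ≤ 1 / 2 →
      ENNReal.ofReal (1 - 2 * (δ : ℝ)) ^ n * J ≤ ENNReal.ofReal α := by
    intro δ hδ hδ'
    have hg := measurable_nearScore ht δ
    have hQp := isProbabilityMeasure_assignLaw (ν.map (constEffect t y)) hg
    let Q : ProbabilityMeasure (Full p) :=
      ⟨assignLaw (ν.map (constEffect t y)) (nearScore t δ), hQp⟩
    have hQm : Q ∈ classSIstr p := assignLaw_constEffect_mem hP ht y hδ hδ' rfl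
    have hQe : ∀ᵐ ω ∂(Q : Measure (Full p)), ω.effect = y := by
      change ∀ᵐ ω ∂(assignLaw (ν.map (constEffect t y)) (nearScore t δ)), ω.effect = y
      have hs : MeasurableSet {ω : Full p | ω.effect = y} :=
        measurableSet_eq_fun Full.measurable_effect measurable_const
      rw [assignLaw, ae_map_iff (measurable_assignRandom hg).aemeasurable hs]
      have hae : ∀ᵐ w ∂(ν.map (constEffect t y)), ∀ b, (w.assign b).effect = y := by
        have hs' : MeasurableSet {w : Potential p | ∀ b, (w.assign b).effect = y} := by
          have : {w : Potential p | ∀ b, (w.assign b).effect = y} = {w | w.2.1 - w.2.2 = y} := by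
            ext w; exact ⟨fun h => h true, fun h _ => h⟩
          rw [this]
          exact measurableSet_eq_fun (by fun_prop) (by fun_prop)
        rw [ae_map_iff hc.aemeasurable hs']
        exact Filter.Eventually.of_forall fun w b => effect_assign_constEffect t y w b
      filter_upwards [Measure.quasiMeasurePreserving_fst.ae hae] with z hz
      exact hz _
    have hcov : (Q : Measure (Full p)).map Full.cov = (P : Measure (Full p)).map Full.cov := by
      have e : (Full.cov : Full p → _) = Prod.fst ∘ Full.potential := rfl
      have e' : (Prod.fst : Potential p → _) ∘ constEffect t y = Prod.fst :=
        funext (constEffect_fst t y)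
      rw [e, ← Measure.map_map measurable_fst Full.measurable_potential,
        ← Measure.map_map measurable_fst Full.measurable_potential]
      change Measure.map Prod.fst
        ((assignLaw (ν.map (constEffect t y)) (nearScore t δ)).map Full.potential) = _
      rw [map_potential_assignLaw _ hg, Measure.map_map measurable_fst hc, e']
    have hle := M.missProb_le_of_effect_eq ρ (hvalid Q hQm) hQe
    rw [M.missProb_eq_lintegral, hcov, ← hh] at hle
    refine le_trans ?_ hle
    change _ ≤ ∫⁻ d, h (fun i => (d i).observe) ∂(Measure.pi fun _ : Fin n =>
      assignLaw (ν.map (constEffect t y)) (nearScore t δ))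
    have hobs : Measurable fun d : Fin n → Full p => h (fun i => (d i).observe) :=
      hhm.comp (measurable_pi_lambda _ fun i =>
        Full.measurable_observe.comp (measurable_pi_apply i))
    rw [lintegral_pi_assignLaw _ hg hobs]
    have hpi : (Measure.pi fun _ : Fin n => ν.map (constEffect t y)) =
        (Measure.pi fun _ : Fin n => ν).map (fun w i => constEffect t y (w i)) :=
      (Measure.pi_map_pi fun _ => hc.aemeasurable).symm
    have hcm : Measurable fun (w : Fin n → Potential p) (i : Fin n) => constEffect t y (w i) :=
      measurable_pi_lambda _ fun i => hc.comp (measurable_pi_apply i)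
    have hm2 : Measurable fun z : (Fin n → Potential p) × (Fin n → I) =>
        h (fun i => (assignRandom (nearScore t δ) (z.1 i, z.2 i)).observe) :=
      hobs.comp (measurable_pi_lambda _ fun i => (measurable_assignRandom hg).comp
        (f := fun z : (Fin n → Potential p) × (Fin n → I) => (z.1 i, z.2 i)) (by fun_prop))
    rw [hpi, lintegral_map hm2.lintegral_prod_right' hcm, ← lintegral_const_mul']
    · refine lintegral_mono fun w => ?_
      -- Only draws with every coordinate in `(δ, 1 - δ]` are kept. There all units follow `t`, and
      -- the observed sample agrees with the one built from the unaltered outcomes.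
      rw [← volume_Ioc_symm_pow δ, mul_comm, ← setLIntegral_const]
      refine le_trans ?_ (setLIntegral_le_lintegral
        (Set.univ.pi fun _ => Set.Ioc δ (unitInterval.symm δ)) _)
      refine setLIntegral_mono_ae'
        (MeasurableSet.univ_pi fun _ => measurableSet_Ioc) (Filter.Eventually.of_forall ?_)
      intro u hu
      refine le_of_eq (congrArg h (funext fun i => ?_))
      rw [assignRandom]
      dsimp only
      rw [decide_le_nearScore t (hu i trivial), constEffect_fst, observe_assign_constEffect]
    · exact ENNReal.pow_ne_top ENNReal.ofReal_ne_top
  -- The shift by `2` keeps `δ k ≤ 1 / 2` from `k = 0` on.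
  let δ : ℕ → I := fun k => ⟨1 / (k + 2 : ℝ), by positivity, by
    rw [div_le_one (by positivity)]; linarith [(Nat.cast_nonneg k : (0 : ℝ) ≤ k)]⟩
  have hlim : Filter.Tendsto (fun k => ((δ k : I) : ℝ)) Filter.atTop (nhds 0) := by
    have := (tendsto_one_div_add_atTop_nhds_zero_nat (𝕜 := ℝ)).comp (Filter.tendsto_add_atTop_nat 1)
    refine this.congr fun k => ?_
    simp only [Function.comp, δ]
    push_cast
    ring_nf
  have hlim' : Filter.Tendsto (fun k => ENNReal.ofReal (1 - 2 * ((δ k : I) : ℝ)) ^ n * J)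
      Filter.atTop (nhds (1 * J)) := by
    refine ENNReal.Tendsto.mul_const ?_ (Or.inl one_ne_zero)
    have h1 := ENNReal.tendsto_ofReal ((hlim.const_mul 2).const_sub 1)
    have h2 := ENNReal.Tendsto.pow (n := n) h1
    simpa using h2
  rw [one_mul] at hlim'
  refine le_of_tendsto' hlim' fun k => main _ ?_ ?_
  · change (0 : ℝ) < 1 / (k + 2 : ℝ); positivity
  · change 1 / (k + 2 : ℝ) ≤ 1 / 2
    exact one_div_le_one_div_of_le (by norm_num) (by linarith [(Nat.cast_nonneg k : (0 : ℝ) ≤ k)])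

end ConformalMetaLearner

end ITE

/-! ### From deterministic rules to randomized treatment -/

namespace ITE

open scoped unitInterval

/-- Finitely many distinct coordinates of an infinite product of copies of `μ` are
independent with law `μ`. -/
theorem map_infinitePi_comp {κ X : Type*} [MeasurableSpace X] {n : ℕ} (μ : Measure X)
    [IsProbabilityMeasure μ] {k : Fin n → κ} (hk : Function.Injective k) :
    (Measure.infinitePi fun _ : κ => μ).map (fun ζ i => ζ (k i)) =
      Measure.pi fun _ : Fin n => μ := by
  classical
  symm
  refine Measure.pi_eq fun s hs => ?_
  have hm : Measurable fun (ζ : κ → X) (i : Fin n) => ζ (k i) :=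
    measurable_pi_lambda _ fun i => measurable_pi_apply _
  rw [Measure.map_apply hm (MeasurableSet.univ_pi hs)]
  have e : (fun (ζ : κ → X) (i : Fin n) => ζ (k i)) ⁻¹' (Set.univ.pi s) =
      Set.pi (Finset.univ.map ⟨k, hk⟩ : Finset κ) (Function.extend k s fun _ => Set.univ) := by
    ext ζ
    simp [Set.mem_pi, hk.extend_apply]
  rw [e, Measure.infinitePi_pi]
  · simp [hk.extend_apply]
  · intro z hz
    obtain ⟨i, -, rfl⟩ := Finset.mem_map.1 hz
    simpa [hk.extend_apply] using hs i

/-- An independent sample of a law without atoms has no ties. -/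
theorem ae_injective_of_noAtoms {X : Type*} [MeasurableSpace X] {n : ℕ} (μ : Measure X)
    [IsProbabilityMeasure μ] {f : X → ℝ} (hf : Measurable f) (h : ∀ c, μ {x | f x = c} = 0) :
    ∀ᵐ w ∂(Measure.pi fun _ : Fin n => μ), Function.Injective fun i => f (w i) := by
  have key : ∀ i j : Fin n, i ≠ j → ∀ᵐ w ∂(Measure.pi fun _ : Fin n => μ), f (w i) ≠ f (w j) := by
    intro i j hij
    have hind := (iIndepFun_pi (μ := fun _ : Fin n => μ) (X := fun _ => f)
      fun _ => hf.aemeasurable).indepFun hij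
    have hi (i : Fin n) : Measurable fun w : Fin n → X => f (w i) :=
      hf.comp (measurable_pi_apply i)
    have hmap (i : Fin n) : (Measure.pi fun _ : Fin n => μ).map (fun w => f (w i)) = μ.map f := by
      have : (fun w : Fin n → X => f (w i)) = f ∘ Function.eval i := rfl
      rw [this, ← Measure.map_map hf (measurable_pi_apply i),
        (measurePreserving_eval (fun _ => μ) i).map_eq]
    rw [indepFun_iff_map_prod_eq_prod_map_map (hi i).aemeasurable (hi j).aemeasurable,
      hmap, hmap] at hind
    have hd : MeasurableSet {z : ℝ × ℝ | z.1 = z.2} := measurableSet_eq_fun measurable_fst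
      measurable_snd
    have h0 : ((μ.map f).prod (μ.map f)) {z : ℝ × ℝ | z.1 = z.2} = 0 := by
      rw [Measure.measure_prod_null hd]
      refine Filter.Eventually.of_forall fun c => ?_
      have : Prod.mk c ⁻¹' {z : ℝ × ℝ | z.1 = z.2} = {c} := by ext; simp [eq_comm]
      change (μ.map f) (Prod.mk c ⁻¹' {z : ℝ × ℝ | z.1 = z.2}) = 0
      rw [this, Measure.map_apply hf (measurableSet_singleton c)]
      exact h c
    rw [← hind, Measure.map_apply ((hi i).prodMk (hi j)) hd] at h0
    exact measure_eq_zero_iff_ae_notMem.1 h0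
  have key' : ∀ᵐ w ∂(Measure.pi fun _ : Fin n => μ), ∀ i j : Fin n, i ≠ j → f (w i) ≠ f (w j) :=
    ae_all_iff.2 fun i => ae_all_iff.2 fun j =>
      Filter.eventually_imp_distrib_left.2 (key i j)
  filter_upwards [key'] with w hw i j hij
  by_contra hne
  exact hw i j hne hij

/-- Distinct reals lie in distinct cells of a fine enough grid. -/
theorem eventually_injective_floor {n : ℕ} {x : Fin n → ℝ} (hx : Function.Injective x) :
    ∀ᶠ N : ℕ in Filter.atTop, Function.Injective fun i => ⌊(N : ℝ) * x i⌋ := by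
  have key : ∀ i j : Fin n, i ≠ j →
      ∀ᶠ N : ℕ in Filter.atTop, ⌊(N : ℝ) * x i⌋ ≠ ⌊(N : ℝ) * x j⌋ := by
    intro i j hij
    have hpos : 0 < |x i - x j| := abs_pos.2 (sub_ne_zero.2 (hx.ne hij))
    have ht := (tendsto_natCast_atTop_atTop (R := ℝ)).atTop_mul_const hpos
    filter_upwards [ht.eventually_ge_atTop 1] with N hN h
    have := Int.abs_sub_lt_one_of_floor_eq_floor h
    rw [← mul_sub, abs_mul, Nat.abs_cast] at this
    linarith
  have key' : ∀ᶠ N : ℕ in Filter.atTop, ∀ i j : Fin n, i ≠ j →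
      ⌊(N : ℝ) * x i⌋ ≠ ⌊(N : ℝ) * x j⌋ := by
    refine Filter.eventually_all.2 fun i => Filter.eventually_all.2 fun j => ?_
    by_cases h : i = j
    · exact Filter.Eventually.of_forall fun _ hne => absurd h hne
    · exact (key i j h).mono fun _ h _ => h
  filter_upwards [key'] with N hN i j hij
  by_contra hne
  exact hN i j hne hij

variable {p n : ℕ}

/-- A bound for all deterministic treatment rules carries over to randomized treatment, if some
covariate has no atoms: randomizing once per cell of a fine grid is indistinguishable, on `n`
units, from randomizing once per unit. -/
theorem lintegral_assignRandom_le (ν : Measure (Potential p)) [IsProbabilityMeasure ν]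
    {f : (Fin n → Full p) → ENNReal} (hf : Measurable f) {c : ENNReal}
    (hfc : ∀ t : (Fin p → ℝ) → Bool, Measurable t →
      ∫⁻ w, f (fun i => (w i).assign (t (w i).1)) ∂(Measure.pi fun _ : Fin n => ν) ≤ c)
    {e : (Fin p → ℝ) → I} (he : Measurable e) {j : Fin p}
    (hj : ∀ a, ν {w | w.1 j = a} = 0) :
    ∫⁻ w, ∫⁻ u, f (fun i => assignRandom e (w i, u i))
      ∂(Measure.pi fun _ : Fin n => (volume : Measure I)) ∂(Measure.pi fun _ : Fin n => ν) ≤ c := by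
  set J : (Fin n → Potential p) → ENNReal := fun w =>
    ∫⁻ u, f (fun i => assignRandom e (w i, u i))
      ∂(Measure.pi fun _ : Fin n => (volume : Measure I))
  let k : ℕ → Potential p → ℤ := fun N w => ⌊(N : ℝ) * w.1 j⌋
  have hk (N : ℕ) : Measurable (k N) := by
    unfold k
    exact Int.measurable_floor.comp (by fun_prop)
  -- One uniform variable per grid cell, shared by all units in that cell.
  let K : ℕ → (Fin n → Potential p) → ENNReal := fun N w =>
    ∫⁻ ζ, f (fun i => assignRandom e (w i, ζ (k N (w i))))
      ∂(Measure.infinitePi fun _ : ℤ => (volume : Measure I))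
  have heval : Measurable fun z : ℤ × (ℤ → I) => z.2 z.1 :=
    measurable_from_prod_countable_right fun m => measurable_pi_apply m
  have hKm (N : ℕ) : Measurable fun z : (Fin n → Potential p) × (ℤ → I) =>
      f (fun i => assignRandom e (z.1 i, z.2 (k N (z.1 i)))) := by
    refine hf.comp (measurable_pi_lambda _ fun i => (measurable_assignRandom he).comp
      (Measurable.prodMk (by fun_prop) ?_))
    exact heval.comp (((hk N).comp (by fun_prop : Measurable
      fun z : (Fin n → Potential p) × (ℤ → I) => z.1 i)).prodMk measurable_snd)
  have hKc (N : ℕ) : ∫⁻ w, K N w ∂(Measure.pi fun _ : Fin n => ν) ≤ c := by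
    unfold K
    rw [lintegral_lintegral_swap (hKm N).aemeasurable]
    refine le_trans (lintegral_mono (g := fun _ => c) fun ζ => ?_) (by simp)
    -- For fixed `ζ` the treatment depends on the covariates alone, so the deterministic bound
    -- applies.
    refine hfc (fun x => decide (ζ ⌊(N : ℝ) * x j⌋ ≤ e x)) (measurable_decide_le ?_ he)
    exact heval.comp ((Int.measurable_floor.comp (by fun_prop)).prodMk measurable_const)
  have hKJ (N : ℕ) (w : Fin n → Potential p) (hw : Function.Injective fun i => k N (w i)) :
      K N w = J w := by
    unfold K J
    have hmu : Measurable fun u : Fin n → I => f (fun i => assignRandom e (w i, u i)) :=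
      hf.comp (measurable_pi_lambda _ fun i => (measurable_assignRandom he).comp (by fun_prop))
    have hev : Measurable fun (ζ : ℤ → I) (i : Fin n) => ζ (k N (w i)) :=
      measurable_pi_lambda _ fun i => measurable_pi_apply _
    -- Units in distinct cells read distinct coordinates of `ζ`, which are independent and uniform.
    rw [← map_infinitePi_comp volume hw, lintegral_map hmu hev]
  have hae : ∀ᵐ w ∂(Measure.pi fun _ : Fin n => ν),
      J w = Filter.liminf (fun N => K N w) Filter.atTop := by
    filter_upwards [ae_injective_of_noAtoms ν (f := fun w : Potential p => w.1 j)
      (by fun_prop) hj] with w hw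
    symm
    refine Filter.Tendsto.liminf_eq (tendsto_const_nhds.congr' ?_)
    filter_upwards [eventually_injective_floor hw] with N hN
    exact (hKJ N w hN).symm
  rw [lintegral_congr_ae hae]
  -- Fatou's lemma suffices: for almost every sample `K N` equals `J` for all large `N`, and no
  -- domination of `f` is needed.
  refine le_trans (lintegral_liminf_le fun N => (hKm N).lintegral_prod_right') ?_
  exact Filter.liminf_le_of_le (by isBoundedDefault) fun b hb => by
    obtain ⟨N, hN⟩ := hb.exists
    exact hN.trans (hKc N)

/-- A meta-learner that is valid for the treatment effect throughout the strong-overlap class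
covers every fixed real. -/
theorem ConformalMetaLearner.missProb_le_of_forall_isValidAt {U : Type*} [MeasurableSpace U]
    (M : ConformalMetaLearner p n U) (ρ : Measure U) [IsProbabilityMeasure ρ] {α : ℝ}
    (hvalid : ∀ Q ∈ classSIstr p, M.IsValidAt ρ Q α) {P : ProbabilityMeasure (Full p)}
    (hP : P ∈ classSI p) (y : ℝ) : M.missProb ρ P α y ≤ ENNReal.ofReal α := by
  obtain ⟨e, he, hPe⟩ := exists_eq_assignLaw hP
  have : IsProbabilityMeasure ((P : Measure (Full p)).map Full.potential) :=
    Measure.isProbabilityMeasure_map Full.measurable_potential.aemeasurable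
  have : IsProbabilityMeasure ((P : Measure (Full p)).map Full.cov) :=
    Measure.isProbabilityMeasure_map Full.measurable_cov.aemeasurable
  have hobs : Measurable fun d : Fin n → Full p =>
      M.missWeight ρ ((P : Measure (Full p)).map Full.cov) α y (fun i => (d i).observe) :=
    (M.measurable_missWeight ρ _ α y).comp (measurable_pi_lambda _ fun i =>
      Full.measurable_observe.comp (measurable_pi_apply i))
  obtain ⟨j, hj⟩ := hP.1.1
  have hj' : ∀ a, ((P : Measure (Full p)).map Full.potential) {w | w.1 j = a} = 0 := fun a => by
    rw [Measure.map_apply Full.measurable_potential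
      (measurableSet_eq_fun (by fun_prop) (by fun_prop))]
    -- Absolute continuity enters as absence of atoms in coordinate `j`.
    have h0 := hj (measure_singleton (μ := volume) a)
    have hm : Measurable fun ω : Full p => ω.cov j :=
      (measurable_pi_apply j).comp Full.measurable_cov
    rw [Measure.map_apply hm (measurableSet_singleton a)] at h0
    exact h0
  have hpi : (Measure.pi fun _ : Fin n => (P : Measure (Full p))) = Measure.pi fun _ : Fin n =>
      assignLaw ((P : Measure (Full p)).map Full.potential) e := by
    rw [← hPe]
  rw [M.missProb_eq_lintegral, hpi, lintegral_pi_assignLaw _ he hobs]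
  exact lintegral_assignRandom_le _ hobs
    (fun t ht => M.lintegral_missWeight_le ρ hvalid hP.1 y ht) he hj'

end ITE

theorem mainTheorem6 {p n : ℕ} (hp : 0 < p) {U : Type*} [MeasurableSpace U]
    (ρ : MeasureTheory.Measure U) [MeasureTheory.IsProbabilityMeasure ρ]
    (M : ITE.ConformalMetaLearner p n U)
    (ε : ℝ) (hε : 0 < ε)
    (hthreshold : ∀ P ∈ ITE.classSIstr p, ε ≤ M.validityThreshold ρ P)
    (α : ℝ) (hα_pos : 0 < α) (hα_lt_one : α < 1) (hα_le : α ≤ ε)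
    (hboundary : ∀ P ∈ ITE.classSIstr p, M.validityThreshold ρ P = α → M.IsValidAt ρ P α) :
    (∀ P ∈ ITE.classSIstr p, ∀ y : ℝ, M.missProb ρ P α y ≤ ENNReal.ofReal α) ∧
    (∀ P ∈ ITE.classSIstr p, M.expectedLength ρ P α = ⊤) ∧
    (⨆ P ∈ ITE.classSIstr p, M.expectedLength ρ P α) = ⊤ := by
  have hvalid : ∀ Q ∈ ITE.classSIstr p, M.IsValidAt ρ Q α := fun Q hQ => by
    -- Strictly below the threshold, validity follows from its definition as a supremum; equality is
    -- the boundary case.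
    rcases (hα_le.trans (hthreshold Q hQ)).lt_or_eq with h | h
    · exact M.isValidAt_of_lt_validityThreshold ρ Q hα_pos h
    · exact hboundary Q hQ h.symm
  have hmiss : ∀ P ∈ ITE.classSIstr p, ∀ y : ℝ, M.missProb ρ P α y ≤ ENNReal.ofReal α :=
    fun P hP y => M.missProb_le_of_forall_isValidAt ρ hvalid hP.1 y
  have hlen : ∀ P ∈ ITE.classSIstr p, M.expectedLength ρ P α = ⊤ :=
    fun P hP => M.expectedLength_eq_top ρ P hα_lt_one (hmiss P hP)
  refine ⟨hmiss, hlen, ?_⟩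
  obtain ⟨P, hP⟩ := ITE.classSIstr_nonempty hp
  rw [← top_le_iff, ← hlen P hP]
  exact le_iSup₂ (f := fun P (_ : P ∈ ITE.classSIstr p) => M.expectedLength ρ P α) P hP
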